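/- All codes are binary and linear: an $[n,m,d]$ code is an $m$-dimensional subspace of $\mathbb{F}_2^n$ with minimum non-zero weight $d$. A code $C$ is self-dual if $C=C^\perp$; a self-dual code is doubly even if all its weights are divisible by $4$, and singly even if some codeword has weight $\equiv 2 \pmod 4$. For a set $X\subseteq\mathbb{F}_2^n$ let $d(X)$ be the minimum weight of its non-zero vectors. A self-dual code of length $n$ is extremal if $d(C)=4\lfloor n/24\rfloor+4$ (or $4\lfloor n/24\rfloor+6$ if $n\equiv 22 \pmod{24}$). For a singly even self-dual code $C$ let $C_0$ be the subcode of codewords of weight divisible by $4$ and $S=C_0^\perp\setminus C$ its shadow; $C$ is s-extremal if $d(S)=\frac n2+4-2d(C)$ (or $d(S)=\frac n2+8-2d(C)$ if $n\equiv 22\pmod{24}$ and $d(C)=4\lfloor n/24\rfloor+6$). Write $C_0^\perp=C_0\cup C_1\cup C_2\cup C_3$ with cosets $C_1,C_2,C_3$ of $C_0$ such that $C=C_0\cup C_2$ and $S=C_1\cup C_3$. Two self-dual codes of length $n$ are neighbors if their intersection has dimension $n/2-1$. The covering radius of a code is the smallest $R$ such that the balls of radius $R$ around its codewords cover $\mathbb{F}_2^n$;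 the Delsarte bound for it is the number of non-zero weights occurring in the dual code. **Theorem.** Let $k\ge 0$ be an integer. (1) Let $C$ be an s-extremal singly even self-dual $[24k+8,12k+4,4k+2]$ code. Then cosets $C_1,C_2,C_3$ as above exist, and for any such cosets $C_0\cup C_1$ and $C_0\cup C_3$ are two distinct codes, they are exactly the doubly even self-dual neighbors of $C$, and both of them are extremal and have covering radius $4k+2$, which equals the Delsarte bound. (2) Conversely, if $D$ is an extremal doubly even self-dual $[24k+8,12k+4,4k+4]$ code with covering radius $4k+2$, then $D$ has a neighbor that is an s-extremal singly even self-dual $[24k+8,12k+4,4k+2]$ code. -/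

import Mathlib

namespace BinaryCode

/-- A binary (linear) code of length `n`; its dimension is `Module.finrank (ZMod 2) C`. The weight
of a vector `x` is `hammingNorm x`. -/
abbrev Code (n : ℕ) := Submodule (ZMod 2) (Fin n → ZMod 2)

variable {n : ℕ}

/-- The vectors orthogonal to all vectors of `X`. For a code `C`, `dual C` is the dual code. -/
def dual (X : Set (Fin n → ZMod 2)) : Code n where
  carrier := {x | ∀ y ∈ X, x ⬝ᵥ y = 0}
  zero_mem' := fun y _ => zero_dotProduct y
  add_mem' := fun {a b} ha hb y hy => by
    rw [add_dotProduct, ha y hy, hb y hy, add_zero]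
  smul_mem' := fun c x hx y hy => by
    rw [smul_dotProduct, hx y hy, smul_zero]

/-- The minimum non-zero weight of the vectors in `X` (`0` if `X` has no non-zero vector). -/
noncomputable def minWeight (X : Set (Fin n → ZMod 2)) : ℕ :=
  sInf {w | ∃ x ∈ X, x ≠ 0 ∧ hammingNorm x = w}

/-- `C` is an `[n, m, d]` code. -/
def HasParams (C : Code n) (m d : ℕ) : Prop :=
  Module.finrank (ZMod 2) C = m ∧ minWeight (C : Set (Fin n → ZMod 2)) = d

def IsSelfDual (C : Code n) : Prop :=
  C = dual (C : Set (Fin n → ZMod 2))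

/-- A doubly even self-dual code. -/
def IsDoublyEvenSelfDual (C : Code n) : Prop :=
  IsSelfDual C ∧ ∀ x ∈ C, hammingNorm x % 4 = 0

/-- A singly even self-dual code. -/
def IsSinglyEvenSelfDual (C : Code n) : Prop :=
  IsSelfDual C ∧ ∃ x ∈ C, hammingNorm x % 4 = 2

/-- An extremal self-dual code: its minimum weight meets the upper bound
`4 ⌊n/24⌋ + 4` (`4 ⌊n/24⌋ + 6` if `n ≡ 22 (mod 24)`). -/
def IsExtremal (C : Code n) : Prop :=
  IsSelfDual C ∧ minWeight (C : Set (Fin n → ZMod 2)) =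
    4 * (n / 24) + (if n % 24 = 22 then 6 else 4)

/-- The set `C₀` of codewords of `C` of weight divisible by four. -/
def doublyEvenPart (C : Code n) : Set (Fin n → ZMod 2) :=
  {x | x ∈ C ∧ hammingNorm x % 4 = 0}

/-- The shadow `S = C₀^⊥ \ C` of a singly even self-dual code `C`. -/
def shadow (C : Code n) : Set (Fin n → ZMod 2) :=
  (dual (doublyEvenPart C) : Set (Fin n → ZMod 2)) \ (C : Set (Fin n → ZMod 2))

/-- An s-extremal singly even self-dual code: `d(S) = n/2 + 4 - 2 d(C)`, and
`d(S) = n/2 + 8 - 2 d(C)` in the exceptional case `n ≡ 22 (mod 24)`, `d(C) = 4 ⌊n/24⌋ + 6`.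
(The length `n` of a self-dual code is even.) -/
def IsSExtremal (C : Code n) : Prop :=
  IsSinglyEvenSelfDual C ∧
    minWeight (shadow C) + 2 * minWeight (C : Set (Fin n → ZMod 2)) =
      n / 2 + (if n % 24 = 22 ∧ minWeight (C : Set (Fin n → ZMod 2)) = 4 * (n / 24) + 6
        then 8 else 4)

/-- `X` is a coset of `Y`. -/
def IsCosetOf (X Y : Set (Fin n → ZMod 2)) : Prop :=
  ∃ v : Fin n → ZMod 2, X = (fun y => v + y) '' Y

/-- `C₁, C₂, C₃` are cosets of `C₀` with `C₀^⊥ = C₀ ∪ C₁ ∪ C₂ ∪ C₃`, `C = C₀ ∪ C₂` and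
`S = C₁ ∪ C₃`. -/
structure IsCosetDecomposition (C : Code n) (C₁ C₂ C₃ : Set (Fin n → ZMod 2)) : Prop where
  coset₁ : IsCosetOf C₁ (doublyEvenPart C)
  coset₂ : IsCosetOf C₂ (doublyEvenPart C)
  coset₃ : IsCosetOf C₃ (doublyEvenPart C)
  dual_eq : (dual (doublyEvenPart C) : Set (Fin n → ZMod 2)) =
    doublyEvenPart C ∪ C₁ ∪ C₂ ∪ C₃
  code_eq : (C : Set (Fin n → ZMod 2)) = doublyEvenPart C ∪ C₂
  shadow_eq : shadow C = C₁ ∪ C₃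

/-- Two self-dual codes of length `n` are neighbors if `dim (C ∩ C') = n/2 - 1`. -/
def IsNeighbor (C C' : Code n) : Prop :=
  IsSelfDual C ∧ IsSelfDual C' ∧
    2 * (Module.finrank (ZMod 2) (C ⊓ C' : Code n) + 1) = n

/-- The smallest `R` such that the balls of radius `R` around the codewords cover the space. -/
noncomputable def coveringRadius (C : Code n) : ℕ :=
  sInf {R | ∀ x : Fin n → ZMod 2, ∃ c ∈ C, hammingDist x c ≤ R}

/-- The Delsarte bound: the number of non-zero weights of the dual code. -/
noncomputable def delsarteBound (C : Code n) : ℕ :=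
  Set.ncard {i : ℕ | 0 < i ∧ i ≤ n ∧
    ∃ x ∈ dual (C : Set (Fin n → ZMod 2)), hammingNorm x = i}

end BinaryCode

/-!
Both directions rest on one construction and one family of character sums.

The construction is `neighbor A x`, the span of a vector `x ∉ A` of even weight and of the codewords
of the self-dual code `A` orthogonal to `x`; it is again self-dual. For a singly even `C` and a
shadow vector `s`, it is `C₀ ∪ (s + C₀)`, because `c ↦ c · s` is a character of `C` with kernel `C₀`
(`IsSelfDual.dotProduct_shadow_eq_zero_iff`). An s-extremal `[24k+8, 12k+4, 4k+2]` code has a shadow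
vector of weight `4k+4`, which is divisible by `4`, and the weights in the shadow are congruent
modulo `4`; so these neighbors are doubly even, of minimum weight at least `4k+4`. In the other
direction `C` is the neighbor of `D` at a leader `x` of a coset of minimum weight `4k+2`.

The character sums are `∑ (-1)^(x · u) p(wt u)` over `u` in a code `E`, for a polynomial `p`. Such a
sum vanishes if `x + E^⊥` has no vector of weight at most `deg p`, because `p(wt u)` is a combination
of characters belonging to vectors of weight at most `deg p` (`sum_character_mul_eval`). They are
used twice.

* If `p` vanishes at all non-zero weights of `E`, only the term `p(0)` is left, so every coset of
  `E^⊥` has a vector of weight at most `deg p`: Delsarte's bound (`exists_add_mem_dual`). A doubly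
  even self-dual code of length `24k+8` and minimum weight at least `4k+4` contains the all-one
  vector, hence has at most `4k+2` non-zero weights `4k+4, 4k+8, …, 20k+4, 24k+8`.
* If `x + D` has minimum weight at least `4k+2` for such a code `D`, take for `p` the polynomial of
  degree `4k+1` whose roots are these weights except `4k+4`. What is left is `p(0)` plus `p(4k+4)`
  times the sum of `(-1)^(x · u)` over the codewords `u` of weight `4k+4`. As `p(0)` and `p(4k+4)`
  have the same sign, some `u` of weight `4k+4` has `x · u = 1`
  (`IsDoublyEvenSelfDual.exists_hammingNorm_eq_not_orthogonal`). This shows that the doubly even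
  neighbors of `C` are extremal (`x` being a codeword of `C` of weight `4k+2`), and that the shadow of
  the neighbor of `D` has minimum weight exactly `4k+4`, so that no upper bound from invariant theory
  is needed for either.
-/

namespace BinaryCode

variable {n : ℕ}

/-! ### Weights and the standard inner product -/

theorem zmod_two_eq_zero_or_one (a : ZMod 2) : a = 0 ∨ a = 1 := by
  revert a; decide

/-- Inclusion-exclusion for supports; modulo `2` the size of the intersection of two supports is
the inner product, so modulo `4` the weight of a sum is governed by it. -/
theorem hammingNorm_add_mod_four (x y : Fin n → ZMod 2) :
    (hammingNorm (x + y) : ZMod 4) =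
      hammingNorm x + hammingNorm y + (if x ⬝ᵥ y = 0 then 0 else 2) := by
  have key : ∀ s : Finset (Fin n),
      (∑ i ∈ s, (if (x + y) i ≠ 0 then 1 else 0 : ZMod 4)) =
        ∑ i ∈ s, (if x i ≠ 0 then 1 else 0 : ZMod 4) +
          ∑ i ∈ s, (if y i ≠ 0 then 1 else 0 : ZMod 4) +
          (if ∑ i ∈ s, x i * y i = 0 then 0 else 2) := by
    intro s
    induction s using Finset.induction_on with
    | empty => simp
    | insert a s ha ih =>
      simp only [Finset.sum_insert ha]
      rw [ih, Pi.add_apply]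
      generalize ∑ i ∈ s, (if x i ≠ 0 then 1 else 0 : ZMod 4) = p
      generalize ∑ i ∈ s, (if y i ≠ 0 then 1 else 0 : ZMod 4) = q
      generalize ∑ i ∈ s, x i * y i = r
      generalize x a = b
      generalize y a = c
      revert p q r b c
      decide
  have hn : ∀ z : Fin n → ZMod 2,
      (hammingNorm z : ZMod 4) = ∑ i, (if z i ≠ 0 then 1 else 0 : ZMod 4) := by
    intro z
    rw [hammingNorm, Finset.sum_boole]
  rw [hn, hn, hn, key]
  rfl

theorem dotProduct_self_eq_hammingNorm (x : Fin n → ZMod 2) : x ⬝ᵥ x = hammingNorm x := by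
  rw [hammingNorm, ← Finset.sum_boole, dotProduct]
  refine Finset.sum_congr rfl fun i _ => ?_
  generalize x i = a
  revert a; decide

theorem dotProduct_one_eq_dotProduct_self (x : Fin n → ZMod 2) : x ⬝ᵥ 1 = x ⬝ᵥ x := by
  refine Finset.sum_congr rfl fun i _ => ?_
  rw [Pi.one_apply]
  generalize x i = a
  revert a; decide

theorem hammingNorm_mod_two_of_dotProduct_self {x : Fin n → ZMod 2} (h : x ⬝ᵥ x = 0) :
    hammingNorm x % 2 = 0 := by
  rw [dotProduct_self_eq_hammingNorm, ZMod.natCast_eq_zero_iff] at h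
  omega

theorem dotProduct_self_of_hammingNorm_mod_two {x : Fin n → ZMod 2} (h : hammingNorm x % 2 = 0) :
    x ⬝ᵥ x = 0 := by
  rw [dotProduct_self_eq_hammingNorm, ZMod.natCast_eq_zero_iff]
  omega

theorem hammingNorm_add_mod_four_of_orthogonal {x y : Fin n → ZMod 2} (h : x ⬝ᵥ y = 0) :
    hammingNorm (x + y) % 4 = (hammingNorm x + hammingNorm y) % 4 := by
  have := hammingNorm_add_mod_four x y
  rw [if_pos h, add_zero] at this
  exact (ZMod.natCast_eq_natCast_iff' _ _ 4).1 (by push_cast; exact this)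

theorem hammingNorm_add_mod_four_of_not_orthogonal {x y : Fin n → ZMod 2} (h : x ⬝ᵥ y ≠ 0) :
    hammingNorm (x + y) % 4 = (hammingNorm x + hammingNorm y + 2) % 4 := by
  have := hammingNorm_add_mod_four x y
  rw [if_neg h] at this
  exact (ZMod.natCast_eq_natCast_iff' _ _ 4).1 (by push_cast; exact this)

theorem hammingNorm_add_one (x : Fin n → ZMod 2) :
    hammingNorm (x + 1) + hammingNorm x = n := by
  have h : ∀ i, ((x + 1) i ≠ 0) ↔ ¬ (x i ≠ 0) := by
    intro i
    rw [Pi.add_apply, Pi.one_apply]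
    generalize x i = a
    revert a; decide
  rw [hammingNorm, hammingNorm, add_comm]
  simp_rw [h]
  rw [Finset.card_filter_add_card_filter_not]
  simp

theorem add_self_eq_zero (x : Fin n → ZMod 2) : x + x = 0 := by
  funext i
  exact CharTwo.add_self_eq_zero (x i)

theorem add_add_cancel_self (x y : Fin n → ZMod 2) : x + y + y = x := by
  rw [add_assoc, add_self_eq_zero, add_zero]

theorem hammingDist_eq_hammingNorm_add (x y : Fin n → ZMod 2) :
    hammingDist x y = hammingNorm (x + y) := by
  rw [hammingDist_eq_hammingNorm]
  congr 1
  funext i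
  rw [Pi.add_apply, Pi.neg_apply, CharTwo.neg_eq, Pi.add_apply]

/-! ### Minimum weight, covering radius and self-dual codes -/

theorem exists_of_minWeight_eq {X : Set (Fin n → ZMod 2)} {d : ℕ} (h : minWeight X = d)
    (hd : 0 < d) : ∃ x ∈ X, hammingNorm x = d := by
  have hne : {w | ∃ x ∈ X, x ≠ 0 ∧ hammingNorm x = w}.Nonempty := by
    by_contra hc
    rw [Set.not_nonempty_iff_eq_empty] at hc
    rw [minWeight, hc, Nat.sInf_empty] at h
    omega
  obtain ⟨x, hx, -, hw⟩ := Nat.sInf_mem hne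
  exact ⟨x, hx, hw.trans h⟩

theorem minWeight_le {X : Set (Fin n → ZMod 2)} {x : Fin n → ZMod 2} (hx : x ∈ X) (h0 : x ≠ 0) :
    minWeight X ≤ hammingNorm x :=
  Nat.sInf_le ⟨x, hx, h0, rfl⟩

theorem minWeight_eq {X : Set (Fin n → ZMod 2)} {d : ℕ} (hd : 0 < d)
    (hex : ∃ x ∈ X, hammingNorm x = d) (hle : ∀ x ∈ X, x ≠ 0 → d ≤ hammingNorm x) :
    minWeight X = d := by
  obtain ⟨x, hx, hw⟩ := hex
  have h0 : x ≠ 0 := by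
    rintro rfl
    simp at hw
    omega
  refine le_antisymm (hw ▸ minWeight_le hx h0) ?_
  refine le_csInf ⟨_, x, hx, h0, rfl⟩ ?_
  rintro w ⟨y, hy, hy0, rfl⟩
  exact hle y hy hy0

theorem coveringRadius_le {C : Code n} {r : ℕ}
    (h : ∀ x : Fin n → ZMod 2, ∃ c ∈ C, hammingDist x c ≤ r) : coveringRadius C ≤ r :=
  Nat.sInf_le h

theorem le_coveringRadius {C : Code n} {r : ℕ} (x : Fin n → ZMod 2)
    (h : ∀ c ∈ C, r ≤ hammingDist x c) : r ≤ coveringRadius C := by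
  refine le_csInf ⟨n, fun y => ⟨0, C.zero_mem, ?_⟩⟩ ?_
  · simpa using hammingDist_le_card_fintype (x := y) (y := 0)
  · intro R hR
    obtain ⟨c, hc, hle⟩ := hR x
    exact (h c hc).trans hle

/-- A coset of `C` whose minimum weight is the covering radius, represented by a vector of minimum
weight. -/
theorem exists_coset_leader {C : Code n} {r : ℕ} (h : coveringRadius C = r) (hr : 0 < r) :
    ∃ x : Fin n → ZMod 2, hammingNorm x = r ∧ ∀ c ∈ C, r ≤ hammingNorm (x + c) := by
  have hlt : r - 1 ∉ {R | ∀ x : Fin n → ZMod 2, ∃ c ∈ C, hammingDist x c ≤ R} := by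
    refine Nat.notMem_of_lt_sInf ?_
    change r - 1 < coveringRadius C
    omega
  have hmem : coveringRadius C ∈
      {R | ∀ x : Fin n → ZMod 2, ∃ c ∈ C, hammingDist x c ≤ R} := by
    refine Nat.sInf_mem ⟨n, fun y => ⟨0, C.zero_mem, ?_⟩⟩
    simpa using hammingDist_le_card_fintype (x := y) (y := 0)
  simp only [Set.mem_ofPred_eq, not_forall, not_exists, not_and, not_le] at hlt
  obtain ⟨y, hy⟩ := hlt
  obtain ⟨c, hc, hle⟩ := hmem y
  simp only [hammingDist_eq_hammingNorm_add] at hy hle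
  have hall : ∀ b ∈ C, r ≤ hammingNorm (y + c + b) := by
    intro b hb
    have := hy (c + b) (C.add_mem hc hb)
    rw [← add_assoc] at this
    omega
  refine ⟨y + c, le_antisymm (h ▸ hle) ?_, hall⟩
  simpa using hall 0 C.zero_mem

theorem mem_dual {X : Set (Fin n → ZMod 2)} {x : Fin n → ZMod 2} :
    x ∈ dual X ↔ ∀ y ∈ X, x ⬝ᵥ y = 0 := Iff.rfl

theorem IsSelfDual.mem_iff {C : Code n} (hC : IsSelfDual C) {x : Fin n → ZMod 2} :
    x ∈ C ↔ ∀ y ∈ C, x ⬝ᵥ y = 0 := by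
  conv_lhs => rw [hC]
  rfl

theorem IsSelfDual.hammingNorm_mod_two {C : Code n} (hC : IsSelfDual C) {x : Fin n → ZMod 2}
    (hx : x ∈ C) : hammingNorm x % 2 = 0 :=
  hammingNorm_mod_two_of_dotProduct_self (hC.mem_iff.1 hx x hx)

theorem IsSelfDual.one_mem {C : Code n} (hC : IsSelfDual C) : (1 : Fin n → ZMod 2) ∈ C := by
  refine hC.mem_iff.2 fun y hy => ?_
  rw [dotProduct_comm, dotProduct_one_eq_dotProduct_self]
  exact hC.mem_iff.1 hy y hy

theorem IsSelfDual.eq_of_le {C D : Code n} (hC : IsSelfDual C) (hD : IsSelfDual D) (h : C ≤ D) :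
    C = D :=
  le_antisymm h fun _ hx => hC.mem_iff.2 fun y hy => hD.mem_iff.1 hx y (h hy)

/-! ### Character sums and the Delsarte bound -/

/-- The character `u ↦ (-1)^(x · u)` of `𝔽₂ⁿ`, with integer values. -/
def character (x u : Fin n → ZMod 2) : ℤ := if x ⬝ᵥ u = 0 then 1 else -1

theorem character_add_left (x y u : Fin n → ZMod 2) :
    character (x + y) u = character x u * character y u := by
  unfold character
  rw [add_dotProduct]
  generalize x ⬝ᵥ u = a
  generalize y ⬝ᵥ u = b
  revert a b; decide

theorem character_add_right (x u v : Fin n → ZMod 2) :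
    character x (u + v) = character x u * character x v := by
  unfold character
  rw [dotProduct_add]
  generalize x ⬝ᵥ u = a
  generalize x ⬝ᵥ v = b
  revert a b; decide

theorem sum_character_eq_zero {E : Code n} [Fintype E] {x : Fin n → ZMod 2}
    (hx : x ∉ dual (E : Set (Fin n → ZMod 2))) : ∑ u : E, character x u = 0 := by
  rw [mem_dual] at hx
  push Not at hx
  obtain ⟨w, hw, hxw⟩ := hx
  have h1 : ∑ u : E, character x u = ∑ u : E, character x (u + w) :=
    (Equiv.sum_comp (Equiv.addRight (⟨w, hw⟩ : E)) fun u : E => character x u).symm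
  have h2 : character x w = -1 := if_neg hxw
  simp only [character_add_right, h2, mul_neg, mul_one, Finset.sum_neg_distrib] at h1
  omega

theorem two_mul_hammingNorm (u : Fin n → ZMod 2) :
    2 * (hammingNorm u : ℤ) = ∑ i, (1 - character (Pi.single i 1) u) := by
  rw [hammingNorm, Finset.card_filter]
  push_cast
  rw [Finset.mul_sum]
  refine Finset.sum_congr rfl fun i _ => ?_
  rw [character, single_dotProduct, one_mul]
  generalize u i = a
  revert a; decide

theorem hammingNorm_single_le (i : Fin n) :
    hammingNorm (Pi.single i 1 : Fin n → ZMod 2) ≤ 1 := by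
  rw [hammingNorm, Finset.card_le_one]
  intro a ha b hb
  simp only [Finset.mem_filter, Finset.mem_univ, true_and, Pi.single_apply] at ha hb
  grind

theorem hammingNorm_add_le (x y : Fin n → ZMod 2) :
    hammingNorm (x + y) ≤ hammingNorm x + hammingNorm y := by
  have := hammingDist_triangle x 0 y
  rw [hammingDist_eq_hammingNorm_add, hammingDist_zero_right, hammingDist_zero_left] at this
  exact this

/-- A power sum of the weights of `E` twisted by a character vanishes if the coset of `E^⊥`
belonging to that character has no vector of weight at most the exponent: the `j`-th power of the
weight is a combination of characters belonging to vectors of weight at most `j`. -/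
theorem sum_character_mul_hammingNorm_pow {E : Code n} [Fintype E] (j : ℕ) :
    ∀ x : Fin n → ZMod 2,
      (∀ v, hammingNorm v ≤ j → x + v ∉ dual (E : Set (Fin n → ZMod 2))) →
      ∑ u : E, character x u * (hammingNorm (u : Fin n → ZMod 2) : ℤ) ^ j = 0 := by
  induction j with
  | zero =>
    intro x hx
    simpa using sum_character_eq_zero (E := E) (x := x) (by simpa using hx 0 (by simp))
  | succ j ih =>
    intro x hx
    have h2 : 2 * ∑ u : E, character x u * (hammingNorm (u : Fin n → ZMod 2) : ℤ) ^ (j + 1) =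
        ∑ i, (∑ u : E, character x u * (hammingNorm (u : Fin n → ZMod 2) : ℤ) ^ j -
          ∑ u : E, character (x + Pi.single i 1) u *
            (hammingNorm (u : Fin n → ZMod 2) : ℤ) ^ j) := by
      simp_rw [← Finset.sum_sub_distrib]
      rw [Finset.sum_comm, Finset.mul_sum]
      refine Finset.sum_congr rfl fun u _ => ?_
      calc 2 * (character x u * (hammingNorm (u : Fin n → ZMod 2) : ℤ) ^ (j + 1))
          = character x u * (hammingNorm (u : Fin n → ZMod 2) : ℤ) ^ j *
              (2 * (hammingNorm (u : Fin n → ZMod 2) : ℤ)) := by ring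
        _ = _ := by
          rw [two_mul_hammingNorm, Finset.mul_sum]
          refine Finset.sum_congr rfl fun i _ => ?_
          rw [character_add_left]
          ring
    rw [Finset.sum_eq_zero (s := Finset.univ (α := Fin n))] at h2
    · omega
    · intro i _
      rw [ih x fun v hv => hx v (by omega), ih, sub_zero]
      intro v hv
      rw [add_assoc]
      refine hx _ ((hammingNorm_add_le _ _).trans ?_)
      have := hammingNorm_single_le i
      omega

theorem sum_character_mul_eval {E : Code n} [Fintype E] {x : Fin n → ZMod 2} (p : Polynomial ℤ)
    (hx : ∀ v, hammingNorm v ≤ p.natDegree → x + v ∉ dual (E : Set (Fin n → ZMod 2))) :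
    ∑ u : E, character x u * p.eval (hammingNorm (u : Fin n → ZMod 2) : ℤ) = 0 := by
  simp_rw [Polynomial.eval_eq_sum_range, Finset.mul_sum]
  rw [Finset.sum_comm]
  refine Finset.sum_eq_zero fun j hj => ?_
  have := sum_character_mul_hammingNorm_pow (E := E) j x fun v hv =>
    hx v (hv.trans (by simpa [Nat.lt_succ_iff] using hj))
  calc _ = p.coeff j * ∑ u : E, character x u * (hammingNorm (u : Fin n → ZMod 2) : ℤ) ^ j := by
        rw [Finset.mul_sum]
        exact Finset.sum_congr rfl fun u _ => by ring
    _ = 0 := by rw [this, mul_zero]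

open Polynomial in
/-- The case of `sum_character_mul_eval` for the polynomial with simple roots at the members
of `R`. -/
theorem sum_character_mul_prod {E : Code n} [Fintype E] {x : Fin n → ZMod 2} (R : Finset ℕ)
    (hx : ∀ v, hammingNorm v ≤ R.card → x + v ∉ dual (E : Set (Fin n → ZMod 2))) :
    ∑ u : E, character x u *
      ∏ r ∈ R, ((hammingNorm (u : Fin n → ZMod 2) : ℤ) - (r : ℤ)) = 0 := by
  have hdeg : (∏ r ∈ R, (X - C (r : ℤ))).natDegree = R.card := by
    rw [natDegree_prod_of_monic _ _ fun r _ => monic_X_sub_C _]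
    simp only [natDegree_X_sub_C, Finset.sum_const, smul_eq_mul, mul_one]
  have := sum_character_mul_eval (E := E) (∏ r ∈ R, (X - C (r : ℤ))) (x := x) (by rwa [hdeg])
  simpa [eval_prod] using this

/-- **Delsarte's bound**: if the non-zero weights of `E` lie in `R`, then every vector is at
distance at most `|R|` from `E^⊥`. -/
theorem exists_add_mem_dual {E : Code n} (R : Finset ℕ) (h0 : 0 ∉ R)
    (hR : ∀ u ∈ E, u ≠ 0 → hammingNorm u ∈ R) (x : Fin n → ZMod 2) :
    ∃ v, hammingNorm v ≤ R.card ∧ x + v ∈ dual (E : Set (Fin n → ZMod 2)) := by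
  classical
  have := Fintype.ofFinite E
  by_contra! hc
  have hsum := sum_character_mul_prod (E := E) (x := x) R hc
  rw [Finset.sum_eq_single (0 : E)] at hsum
  · refine h0 ?_
    simpa [character, Finset.prod_eq_zero_iff] using hsum
  · intro u _ hu
    rw [Finset.prod_eq_zero (hR u u.2 (by simpa using hu)) (sub_self _), mul_zero]
  · simp

theorem coveringRadius_dual_le {E : Code n} (R : Finset ℕ) (h0 : 0 ∉ R)
    (hR : ∀ u ∈ E, u ≠ 0 → hammingNorm u ∈ R) :
    coveringRadius (dual (E : Set (Fin n → ZMod 2))) ≤ R.card := by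
  refine coveringRadius_le fun x => ?_
  obtain ⟨v, hv, hmem⟩ := exists_add_mem_dual R h0 hR x
  refine ⟨x + v, hmem, ?_⟩
  rwa [hammingDist_eq_hammingNorm_add, ← add_assoc, add_self_eq_zero, zero_add]

theorem IsSelfDual.coveringRadius_le_delsarteBound {D : Code n} (hD : IsSelfDual D) :
    coveringRadius D ≤ delsarteBound D := by
  classical
  have hfin : {i : ℕ | 0 < i ∧ i ≤ n ∧
      ∃ x ∈ dual (D : Set (Fin n → ZMod 2)), hammingNorm x = i}.Finite :=
    (Set.finite_Iic n).subset fun i hi => hi.2.1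
  rw [delsarteBound, Set.ncard_eq_toFinset_card _ hfin]
  conv_lhs => rw [hD]
  refine coveringRadius_dual_le _ (by simp) fun u hu h0 => ?_
  rw [Set.Finite.mem_toFinset]
  refine ⟨hammingNorm_pos_iff.2 h0, ?_, u, hD ▸ hu, rfl⟩
  simpa using hammingNorm_le_card_fintype (x := u)

/-! ### Neighbors -/

/-- The neighbor of a self-dual code `A` at a vector `x` of even weight: the span of `x` and of the
codewords orthogonal to `x`. -/
def neighbor (A : Code n) (x : Fin n → ZMod 2) : Code n where
  carrier := {v | v ⬝ᵥ x = 0 ∧ (v ∈ A ∨ v + x ∈ A)}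
  zero_mem' := ⟨zero_dotProduct x, Or.inl A.zero_mem⟩
  add_mem' := by
    rintro a b ⟨ha, ha'⟩ ⟨hb, hb'⟩
    refine ⟨by rw [add_dotProduct, ha, hb, add_zero], ?_⟩
    rcases ha' with ha' | ha' <;> rcases hb' with hb' | hb'
    · exact Or.inl (A.add_mem ha' hb')
    · exact Or.inr (by simpa [add_assoc] using A.add_mem ha' hb')
    · exact Or.inr (by simpa [add_right_comm] using A.add_mem ha' hb')
    · refine Or.inl ?_
      have := A.add_mem ha' hb'
      rwa [add_add_add_comm, add_self_eq_zero, add_zero] at this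
  smul_mem' := by
    rintro c a ⟨ha, ha'⟩
    rcases zmod_two_eq_zero_or_one c with rfl | rfl
    · rw [zero_smul]
      exact ⟨zero_dotProduct x, Or.inl A.zero_mem⟩
    · rw [one_smul]
      exact ⟨ha, ha'⟩

theorem mem_neighbor {A : Code n} {x v : Fin n → ZMod 2} :
    v ∈ neighbor A x ↔ v ⬝ᵥ x = 0 ∧ (v ∈ A ∨ v + x ∈ A) := Iff.rfl

theorem self_mem_neighbor {A : Code n} {x : Fin n → ZMod 2} (hx : x ⬝ᵥ x = 0) :
    x ∈ neighbor A x :=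
  ⟨hx, Or.inr (by rw [add_self_eq_zero]; exact A.zero_mem)⟩

theorem IsSelfDual.exists_not_orthogonal {A : Code n} (hA : IsSelfDual A) {x : Fin n → ZMod 2}
    (hx : x ∉ A) : ∃ a ∈ A, a ⬝ᵥ x = 1 := by
  rw [hA.mem_iff] at hx
  push Not at hx
  obtain ⟨a, ha, hax⟩ := hx
  exact ⟨a, ha, by rw [dotProduct_comm]; exact (zmod_two_eq_zero_or_one _).resolve_left hax⟩

/-- If `y` is orthogonal to the hyperplane `A ∩ x^⊥` of `A`, then its inner products with `A` are
those of `0` or of `x`. -/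
theorem IsSelfDual.mem_or_add_mem {A : Code n} (hA : IsSelfDual A) {x y : Fin n → ZMod 2}
    (hx : x ∉ A) (hy : ∀ a ∈ A, a ⬝ᵥ x = 0 → y ⬝ᵥ a = 0) : y ∈ A ∨ y + x ∈ A := by
  obtain ⟨b, hb, hbx⟩ := hA.exists_not_orthogonal hx
  have hsum : ∀ a ∈ A, a ⬝ᵥ x = 1 → y ⬝ᵥ a = y ⬝ᵥ b := by
    intro a ha hax
    have h := hy (a + b) (A.add_mem ha hb)
      (by rw [add_dotProduct, hax, hbx]; decide)
    rw [dotProduct_add] at h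
    exact CharTwo.add_eq_zero.1 h
  rw [hA.mem_iff, hA.mem_iff]
  rcases zmod_two_eq_zero_or_one (y ⬝ᵥ b) with h | h
  · refine Or.inl fun a ha => ?_
    rcases zmod_two_eq_zero_or_one (a ⬝ᵥ x) with h' | h'
    · exact hy a ha h'
    · exact (hsum a ha h').trans h
  · refine Or.inr fun a ha => ?_
    rw [add_dotProduct, dotProduct_comm x a]
    rcases zmod_two_eq_zero_or_one (a ⬝ᵥ x) with h' | h'
    · rw [hy a ha h', h', add_zero]
    · rw [hsum a ha h', h, h']; decide

theorem IsSelfDual.neighbor {A : Code n} (hA : IsSelfDual A) {x : Fin n → ZMod 2} (hx : x ∉ A)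
    (hxx : x ⬝ᵥ x = 0) : IsSelfDual (neighbor A x) := by
  refine le_antisymm ?_ ?_
  · rintro v ⟨hv, hv'⟩ w ⟨hw, hw'⟩
    have hxw : x ⬝ᵥ w = 0 := by rwa [dotProduct_comm]
    rcases hv' with hv' | hv' <;> rcases hw' with hw' | hw'
    · exact hA.mem_iff.1 hv' w hw'
    · simpa [dotProduct_add, hv] using hA.mem_iff.1 hv' _ hw'
    · simpa [add_dotProduct, hxw] using hA.mem_iff.1 hv' _ hw'
    · simpa [add_dotProduct, dotProduct_add, hxw, hv, hxx] using hA.mem_iff.1 hv' _ hw'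
  · intro y hy
    refine ⟨hy x (self_mem_neighbor hxx), hA.mem_or_add_mem hx fun a ha hax => ?_⟩
    exact hy a ⟨hax, Or.inl ha⟩

theorem mem_inf_neighbor {A : Code n} {x v : Fin n → ZMod 2} :
    v ∈ A ⊓ neighbor A x ↔ v ∈ A ∧ v ⬝ᵥ x = 0 := by
  rw [Submodule.mem_inf, mem_neighbor]
  tauto

theorem finrank_of_coset_cover {E A : Code n} (hEA : E ≤ A) {a : Fin n → ZMod 2} (ha : a ∈ A)
    (haE : a ∉ E) (h : ∀ v ∈ A, v ∈ E ∨ v + a ∈ E) :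
    Module.finrank (ZMod 2) A = Module.finrank (ZMod 2) E + 1 := by
  have h0 : a ≠ 0 := fun h => haE (h ▸ E.zero_mem)
  have hsup : A = E ⊔ Submodule.span (ZMod 2) {a} := by
    refine le_antisymm (fun v hv => ?_)
      (sup_le hEA ((Submodule.span_singleton_le_iff_mem _ _).2 ha))
    rcases h v hv with hv | hv
    · exact Submodule.mem_sup_left hv
    · rw [← add_add_cancel_self v a]
      exact Submodule.add_mem_sup hv (Submodule.mem_span_singleton_self a)
  have hinf : E ⊓ Submodule.span (ZMod 2) {a} = ⊥ := by
    rw [eq_bot_iff]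
    rintro v ⟨hv, hv'⟩
    obtain ⟨c, rfl⟩ := Submodule.mem_span_singleton.1 hv'
    rcases zmod_two_eq_zero_or_one c with rfl | rfl
    · simp
    · exact absurd (by simpa using hv) haE
  have := Submodule.finrank_sup_add_finrank_inf_eq E (Submodule.span (ZMod 2) {a})
  rw [hinf, finrank_bot, finrank_span_singleton h0, ← hsup] at this
  exact this

theorem IsSelfDual.finrank_eq_inf_neighbor_add_one {A : Code n} (hA : IsSelfDual A)
    {x : Fin n → ZMod 2} (hx : x ∉ A) :
    Module.finrank (ZMod 2) A =
      Module.finrank (ZMod 2) (A ⊓ BinaryCode.neighbor A x : Code n) + 1 := by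
  obtain ⟨b, hb, hbx⟩ := hA.exists_not_orthogonal hx
  refine finrank_of_coset_cover inf_le_left hb ?_ fun v hv => ?_
  · rw [mem_inf_neighbor, hbx]
    simp
  · rw [mem_inf_neighbor, mem_inf_neighbor, add_dotProduct, hbx]
    rcases zmod_two_eq_zero_or_one (v ⬝ᵥ x) with h | h
    · exact Or.inl ⟨hv, h⟩
    · exact Or.inr ⟨A.add_mem hv hb, by rw [h]; decide⟩

theorem finrank_neighbor_eq_inf_add_one {A : Code n} {x : Fin n → ZMod 2} (hx : x ∉ A)
    (hxx : x ⬝ᵥ x = 0) :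
    Module.finrank (ZMod 2) (neighbor A x) =
      Module.finrank (ZMod 2) (A ⊓ neighbor A x : Code n) + 1 := by
  refine finrank_of_coset_cover inf_le_right (self_mem_neighbor hxx) (fun h => hx h.1) fun v hv => ?_
  rw [mem_inf_neighbor, mem_inf_neighbor, add_dotProduct, hxx, hv.1]
  have := hv.2
  tauto

/-! ### Doubly even self-dual codes of length `24k + 8` -/

/-- The weights that a non-zero codeword of a doubly even self-dual code of length `24k + 8` and
minimum weight at least `4k + 4` can have. -/
def possibleWeights (k : ℕ) : Finset ℕ :=
  insert (24 * k + 8) ((Finset.Icc (k + 1) (5 * k + 1)).image (4 * ·))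

theorem card_possibleWeights (k : ℕ) : (possibleWeights k).card = 4 * k + 2 := by
  rw [possibleWeights, Finset.card_insert_of_notMem, Finset.card_image_of_injective,
    Nat.card_Icc]
  · omega
  · intro a b h
    simpa using h
  · simp only [Finset.mem_image, Finset.mem_Icc, not_exists, not_and]
    omega

section

variable {k : ℕ} {D : Code (24 * k + 8)}

theorem IsDoublyEvenSelfDual.hammingNorm_mem_possibleWeights (hD : IsDoublyEvenSelfDual D)
    (hmin : ∀ x ∈ D, x ≠ 0 → 4 * k + 4 ≤ hammingNorm x) {u : Fin (24 * k + 8) → ZMod 2}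
    (hu : u ∈ D) (h0 : u ≠ 0) : hammingNorm u ∈ possibleWeights k := by
  have h4 := hD.2 u hu
  have hlow := hmin u hu h0
  have hcompl := hammingNorm_add_one u
  simp only [possibleWeights, Finset.mem_insert, Finset.mem_image, Finset.mem_Icc]
  by_cases h1 : u + 1 = 0
  · rw [h1, hammingNorm_zero] at hcompl
    omega
  · have := hmin _ (D.add_mem hu hD.1.one_mem) h1
    exact Or.inr ⟨hammingNorm u / 4, by omega, by omega⟩

theorem IsDoublyEvenSelfDual.delsarteBound_le (hD : IsDoublyEvenSelfDual D)
    (hmin : ∀ x ∈ D, x ≠ 0 → 4 * k + 4 ≤ hammingNorm x) : delsarteBound D ≤ 4 * k + 2 := by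
  rw [delsarteBound, ← card_possibleWeights, ← Set.ncard_coe_finset]
  refine Set.ncard_le_ncard ?_ (Finset.finite_toSet _)
  rintro i ⟨hi, -, u, hu, rfl⟩
  exact hD.hammingNorm_mem_possibleWeights hmin (hD.1.symm ▸ hu) (hammingNorm_pos_iff.1 hi)

/-- If a coset `x + D` has no vector of weight below `4k + 2`, then the codewords of weight
`4k + 4` are not all orthogonal to `x`. -/
theorem IsDoublyEvenSelfDual.exists_hammingNorm_eq_not_orthogonal (hD : IsDoublyEvenSelfDual D)
    (hmin : ∀ x ∈ D, x ≠ 0 → 4 * k + 4 ≤ hammingNorm x) {x : Fin (24 * k + 8) → ZMod 2}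
    (hx : ∀ c ∈ D, 4 * k + 2 ≤ hammingNorm (x + c)) :
    ∃ u ∈ D, hammingNorm u = 4 * k + 4 ∧ u ⬝ᵥ x = 1 := by
  classical
  have := Fintype.ofFinite D
  by_contra! hc
  -- The polynomial with these `4k + 1` roots has the same sign at `0` and at `4k + 4`.
  have hmem : 4 * k + 4 ∈ possibleWeights k :=
    Finset.mem_insert_of_mem (Finset.mem_image.2 ⟨k + 1, Finset.mem_Icc.2 (by omega), by ring⟩)
  have hcard : ((possibleWeights k).erase (4 * k + 4)).card = 4 * k + 1 := by
    rw [Finset.card_erase_of_mem hmem, card_possibleWeights]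
    omega
  set R := (possibleWeights k).erase (4 * k + 4) with hR
  have hlarge : ∀ r ∈ R, 4 * k + 4 < r := by
    intro r hr
    simp only [hR, possibleWeights, Finset.mem_erase, Finset.mem_insert, Finset.mem_image,
      Finset.mem_Icc] at hr
    omega
  have hsum := sum_character_mul_prod (E := D) (x := x) R (fun v hv hmem => by
    have := hx (x + v) (hD.1.symm ▸ hmem)
    rw [← add_assoc, add_self_eq_zero, zero_add] at this
    omega)
  set p : ℕ → ℤ := fun w => ∏ r ∈ R, ((w : ℤ) - (r : ℤ)) with hp
  have hsign : ∀ w, w ≤ 4 * k + 4 → 0 < p 0 * p w := by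
    intro w hw
    rw [hp, ← Finset.prod_mul_distrib]
    refine Finset.prod_pos fun r hr => ?_
    have := hlarge r hr
    refine mul_pos_of_neg_of_neg ?_ ?_ <;> push_cast <;> omega
  have hpos : 0 < ∑ u : D, p 0 * (character x u * p (hammingNorm (u : Fin (24 * k + 8) → ZMod 2))) := by
    refine Finset.sum_pos' (fun u _ => ?_) ⟨0, Finset.mem_univ _, ?_⟩
    · by_cases hu : (u : Fin (24 * k + 8) → ZMod 2) = 0
      · rw [hu]
        simpa [character] using (hsign 0 (by omega)).le
      · by_cases hw : hammingNorm (u : Fin (24 * k + 8) → ZMod 2) = 4 * k + 4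
        · have h1 : character x u = 1 := by
            refine if_pos ?_
            rw [dotProduct_comm]
            exact (zmod_two_eq_zero_or_one _).resolve_right (hc u u.2 hw)
          rw [hw, h1, one_mul]
          exact (hsign _ le_rfl).le
        · have h0 : p (hammingNorm (u : Fin (24 * k + 8) → ZMod 2)) = 0 :=
            Finset.prod_eq_zero (Finset.mem_erase.2
              ⟨hw, hD.hammingNorm_mem_possibleWeights hmin u.2 hu⟩) (sub_self _)
          rw [h0, mul_zero, mul_zero]
    · simpa [character] using hsign 0 (by omega)
  rw [← Finset.mul_sum, hsum, mul_zero] at hpos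
  exact lt_irrefl _ hpos

theorem IsDoublyEvenSelfDual.extremal_and_coveringRadius (hD : IsDoublyEvenSelfDual D)
    (hmin : ∀ x ∈ D, x ≠ 0 → 4 * k + 4 ≤ hammingNorm x) {x : Fin (24 * k + 8) → ZMod 2}
    (hx : ∀ c ∈ D, 4 * k + 2 ≤ hammingNorm (x + c)) :
    IsExtremal D ∧ coveringRadius D = 4 * k + 2 ∧ coveringRadius D = delsarteBound D := by
  obtain ⟨u, hu, hw, -⟩ := hD.exists_hammingNorm_eq_not_orthogonal hmin hx
  have h1 : 4 * k + 2 ≤ coveringRadius D :=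
    le_coveringRadius x fun c hc => by rw [hammingDist_eq_hammingNorm_add]; exact hx c hc
  have h2 := hD.1.coveringRadius_le_delsarteBound
  have h3 := hD.delsarteBound_le hmin
  refine ⟨⟨hD.1, ?_⟩, by omega, by omega⟩
  rw [minWeight_eq (by omega) ⟨u, hu, hw⟩ hmin, if_neg (by omega)]
  omega

end

/-! ### The shadow of a singly even self-dual code -/

section

variable {C : Code n} {s : Fin n → ZMod 2}

theorem mem_doublyEvenPart {x : Fin n → ZMod 2} :
    x ∈ doublyEvenPart C ↔ x ∈ C ∧ hammingNorm x % 4 = 0 := Iff.rfl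

theorem mem_shadow :
    s ∈ shadow C ↔ (∀ c ∈ C, hammingNorm c % 4 = 0 → s ⬝ᵥ c = 0) ∧ s ∉ C :=
  and_congr_left' ⟨fun h c hc hw => h c ⟨hc, hw⟩, fun h c hc => h c hc.1 hc.2⟩

theorem add_mem_shadow (hC : IsSelfDual C) (hs : s ∈ shadow C) {c : Fin n → ZMod 2} (hc : c ∈ C) :
    s + c ∈ shadow C := by
  rw [mem_shadow] at hs ⊢
  refine ⟨fun b hb hw => ?_, fun h => hs.2 ?_⟩
  · rw [add_dotProduct, hs.1 b hb hw, hC.mem_iff.1 hc b hb, add_zero]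
  · have := C.add_mem h hc
    rwa [add_add_cancel_self] at this

/-- A shadow vector induces on `C` the character with kernel the doubly even part. -/
theorem IsSelfDual.dotProduct_shadow_eq_zero_iff (hC : IsSelfDual C) (hs : s ∈ shadow C)
    {c : Fin n → ZMod 2} (hc : c ∈ C) : c ⬝ᵥ s = 0 ↔ hammingNorm c % 4 = 0 := by
  rw [mem_shadow] at hs
  have hzero : ∀ a ∈ C, hammingNorm a % 4 = 0 → a ⬝ᵥ s = 0 := fun a ha hw => by
    rw [dotProduct_comm]; exact hs.1 a ha hw
  refine ⟨fun h => ?_, hzero c hc⟩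
  obtain ⟨b, hb, hbs⟩ := hC.exists_not_orthogonal hs.2
  by_contra hw
  have hbw : hammingNorm b % 4 ≠ 0 := fun hbw => by simp [hzero b hb hbw] at hbs
  have hc2 := hC.hammingNorm_mod_two hc
  have hb2 := hC.hammingNorm_mod_two hb
  have hadd := hammingNorm_add_mod_four_of_orthogonal (hC.mem_iff.1 hc b hb)
  have := hzero (c + b) (C.add_mem hc hb) (by omega)
  rw [add_dotProduct, h, hbs] at this
  simp at this

theorem IsSelfDual.add_mem_of_mem_shadow (hC : IsSelfDual C) (hs : s ∈ shadow C)
    {t : Fin n → ZMod 2} (ht : t ∈ shadow C) : t + s ∈ C := by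
  refine (hC.mem_or_add_mem hs.2 fun a ha has => ?_).resolve_left ht.2
  exact ht.1 a ⟨ha, (hC.dotProduct_shadow_eq_zero_iff hs ha).1 has⟩

/-- All weights of the shadow are congruent modulo `4`. -/
theorem IsSelfDual.shadow_hammingNorm_mod_four (hC : IsSelfDual C) (hs : s ∈ shadow C)
    (hs4 : hammingNorm s % 4 = 0) {t : Fin n → ZMod 2} (ht : t ∈ shadow C) :
    hammingNorm t % 4 = 0 := by
  have hts := hC.add_mem_of_mem_shadow hs ht
  have hiff := hC.dotProduct_shadow_eq_zero_iff hs hts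
  have h2 := hC.hammingNorm_mod_two hts
  rw [← add_add_cancel_self t s]
  by_cases h : (t + s) ⬝ᵥ s = 0
  · rw [hammingNorm_add_mod_four_of_orthogonal h]
    have := hiff.1 h
    omega
  · rw [hammingNorm_add_mod_four_of_not_orthogonal h]
    have := mt hiff.2 h
    omega

theorem IsSelfDual.coe_neighbor_shadow (hC : IsSelfDual C) (hs : s ∈ shadow C)
    (hss : s ⬝ᵥ s = 0) :
    (BinaryCode.neighbor C s : Set (Fin n → ZMod 2)) =
      doublyEvenPart C ∪ (fun y => s + y) '' doublyEvenPart C := by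
  ext v
  rw [SetLike.mem_coe, mem_neighbor, Set.mem_union, mem_doublyEvenPart]
  constructor
  · rintro ⟨hv, hv' | hv'⟩
    · exact Or.inl ⟨hv', (hC.dotProduct_shadow_eq_zero_iff hs hv').1 hv⟩
    · refine Or.inr ⟨v + s, ⟨hv', (hC.dotProduct_shadow_eq_zero_iff hs hv').1 ?_⟩, ?_⟩
      · rw [add_dotProduct, hv, hss, add_zero]
      · change s + (v + s) = v
        rw [add_comm, add_add_cancel_self]
  · rintro (⟨hv, hw⟩ | ⟨y, ⟨hy, hw⟩, rfl⟩)
    · exact ⟨(hC.dotProduct_shadow_eq_zero_iff hs hv).2 hw, Or.inl hv⟩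
    · refine ⟨?_, Or.inr ?_⟩
      · change (s + y) ⬝ᵥ s = 0
        rw [add_dotProduct, hss, (hC.dotProduct_shadow_eq_zero_iff hs hy).2 hw, add_zero]
      · change s + y + s ∈ C
        rwa [add_comm s y, add_add_cancel_self]

theorem IsSelfDual.neighbor_shadow_doublyEven (hC : IsSelfDual C) (hs : s ∈ shadow C)
    (hs4 : hammingNorm s % 4 = 0) : IsDoublyEvenSelfDual (BinaryCode.neighbor C s) := by
  have hss : s ⬝ᵥ s = 0 := dotProduct_self_of_hammingNorm_mod_two (by omega)
  refine ⟨hC.neighbor hs.2 hss, ?_⟩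
  rintro v ⟨hv, hv' | hv'⟩
  · exact (hC.dotProduct_shadow_eq_zero_iff hs hv').1 hv
  · rw [← add_add_cancel_self v s, add_comm]
    exact hC.shadow_hammingNorm_mod_four hs hs4 (add_mem_shadow hC hs hv')

theorem neighbor_le {D : Code n} (hss : s ⬝ᵥ s = 0) (hle : C ⊓ neighbor C s ≤ D) (hsD : s ∈ D) :
    neighbor C s ≤ D := by
  rintro v ⟨hv, hv' | hv'⟩
  · exact hle (mem_inf_neighbor.2 ⟨hv', hv⟩)
  · rw [← add_add_cancel_self v s]
    refine D.add_mem (hle (mem_inf_neighbor.2 ⟨hv', ?_⟩)) hsD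
    rw [add_dotProduct, hv, hss, add_zero]

theorem IsSinglyEvenSelfDual.exists_isCosetDecomposition (hC : IsSinglyEvenSelfDual C)
    (hs : s ∈ shadow C) :
    ∃ C₁ C₂ C₃ : Set (Fin n → ZMod 2), IsCosetDecomposition C C₁ C₂ C₃ := by
  obtain ⟨hsd, b, hb, hb4⟩ := hC
  have hcode : (C : Set (Fin n → ZMod 2)) =
      doublyEvenPart C ∪ (fun y => b + y) '' doublyEvenPart C := by
    ext v
    constructor
    · intro hv
      have h2 := hsd.hammingNorm_mod_two hv
      by_cases h4 : hammingNorm v % 4 = 0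
      · exact Or.inl ⟨hv, h4⟩
      · refine Or.inr ⟨v + b, ⟨C.add_mem hv hb, ?_⟩, ?_⟩
        · rw [hammingNorm_add_mod_four_of_orthogonal (hsd.mem_iff.1 hv b hb)]
          omega
        · change b + (v + b) = v
          rw [add_comm, add_add_cancel_self]
    · rintro (hv | ⟨y, hy, rfl⟩)
      · exact hv.1
      · exact C.add_mem hb hy.1
  have hshadow : shadow C = (fun y => s + y) '' doublyEvenPart C ∪
      (fun y => (s + b) + y) '' doublyEvenPart C := by
    ext v
    constructor
    · intro hv
      have hvs : v + s ∈ (C : Set (Fin n → ZMod 2)) := hsd.add_mem_of_mem_shadow hs hv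
      have hv' : s + (v + s) = v := by rw [add_comm, add_add_cancel_self]
      rw [hcode] at hvs
      rcases hvs with h | ⟨y, hy, h⟩
      · exact Or.inl ⟨v + s, h, hv'⟩
      · refine Or.inr ⟨y, hy, ?_⟩
        change b + y = v + s at h
        change s + b + y = v
        rw [add_assoc, h, hv']
    · rintro (⟨y, hy, rfl⟩ | ⟨y, hy, rfl⟩)
      · exact add_mem_shadow hsd hs hy.1
      · exact add_mem_shadow hsd (add_mem_shadow hsd hs hb) hy.1
  refine ⟨_, _, _, ⟨s, rfl⟩, ⟨b, rfl⟩, ⟨s + b, rfl⟩, ?_, hcode, hshadow⟩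
  have hsub : (C : Set (Fin n → ZMod 2)) ⊆ (dual (doublyEvenPart C) : Set (Fin n → ZMod 2)) :=
    fun v hv y hy => hsd.mem_iff.1 hv y hy.1
  rw [← Set.union_sdiff_cancel hsub]
  change (C : Set (Fin n → ZMod 2)) ∪ shadow C = _
  rw [hshadow]
  conv_lhs => rw [hcode]
  ext v
  simp only [Set.mem_union]
  tauto

theorem IsCosetDecomposition.exists_representatives {C₁ C₂ C₃ : Set (Fin n → ZMod 2)}
    (h : IsCosetDecomposition C C₁ C₂ C₃) : ∃ s₁ ∈ shadow C, ∃ s₃ ∈ shadow C,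
      C₁ = (fun y => s₁ + y) '' doublyEvenPart C ∧ C₃ = (fun y => s₃ + y) '' doublyEvenPart C := by
  obtain ⟨s₁, h₁⟩ := h.coset₁
  obtain ⟨s₃, h₃⟩ := h.coset₃
  have h0 : (0 : Fin n → ZMod 2) ∈ doublyEvenPart C := ⟨C.zero_mem, by simp⟩
  refine ⟨s₁, ?_, s₃, ?_, h₁, h₃⟩ <;> rw [h.shadow_eq]
  · exact Or.inl (h₁ ▸ ⟨0, h0, add_zero _⟩)
  · exact Or.inr (h₃ ▸ ⟨0, h0, add_zero _⟩)

/-- A doubly even self-dual code meeting `C` in a subcode of index `2` contains the doubly even part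
of `C`, and a shadow vector. -/
theorem IsSinglyEvenSelfDual.doublyEvenPart_subset_and_exists_mem_shadow (hC : IsSinglyEvenSelfDual C) {D : Code n}
    (hD : IsDoublyEvenSelfDual D) (hs : s ∈ shadow C)
    (hrank : Module.finrank (ZMod 2) C = Module.finrank (ZMod 2) (C ⊓ D : Code n) + 1) :
    doublyEvenPart C ⊆ D ∧ ∃ t ∈ D, t ∈ shadow C := by
  have hinf : C ⊓ D = C ⊓ neighbor C s := by
    refine Submodule.eq_of_le_of_finrank_eq (fun v hv => ?_) ?_
    · exact mem_inf_neighbor.2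
        ⟨hv.1, (hC.1.dotProduct_shadow_eq_zero_iff hs hv.1).2 (hD.2 v hv.2)⟩
    · have := hC.1.finrank_eq_inf_neighbor_add_one hs.2
      omega
  have hsub : doublyEvenPart C ⊆ D := by
    intro v hv
    have : v ∈ C ⊓ neighbor C s :=
      mem_inf_neighbor.2 ⟨hv.1, (hC.1.dotProduct_shadow_eq_zero_iff hs hv.1).2 hv.2⟩
    rw [← hinf] at this
    exact this.2
  refine ⟨hsub, ?_⟩
  by_contra! hc
  have hle : D ≤ C := fun t ht => by
    by_contra htC
    exact hc t ht ⟨fun y hy => hD.1.mem_iff.1 ht y (hsub hy), htC⟩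
  obtain ⟨b, hb, hb4⟩ := hC.2
  rw [← hD.1.eq_of_le hC.1 hle] at hb
  have := hD.2 b hb
  omega

theorem IsSinglyEvenSelfDual.doublyEven_neighbor_iff (hC : IsSinglyEvenSelfDual C)
    {s₁ s₃ : Fin n → ZMod 2} (hs₁ : s₁ ∈ shadow C) (hs₃ : s₃ ∈ shadow C)
    (h₁ : hammingNorm s₁ % 4 = 0) (h₃ : hammingNorm s₃ % 4 = 0)
    (hshadow : shadow C = (fun y => s₁ + y) '' doublyEvenPart C ∪
      (fun y => s₃ + y) '' doublyEvenPart C)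
    (hrank : 2 * Module.finrank (ZMod 2) C = n) (D : Code n) :
    (IsDoublyEvenSelfDual D ∧ IsNeighbor C D) ↔ (D = neighbor C s₁ ∨ D = neighbor C s₃) := by
  constructor
  · rintro ⟨hD, -, -, hCD⟩
    obtain ⟨hsub, t, htD, ht⟩ := hC.doublyEvenPart_subset_and_exists_mem_shadow hD hs₁ (by omega)
    have key : ∀ s ∈ shadow C, hammingNorm s % 4 = 0 →
        t ∈ (fun y => s + y) '' doublyEvenPart C → D = neighbor C s := by
      rintro s hs hs4 ⟨y, hy, rfl⟩
      have hsD : s ∈ D := by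
        rw [← add_add_cancel_self s y]
        exact D.add_mem htD (hsub hy)
      have hle : neighbor C s ≤ D := by
        refine neighbor_le (dotProduct_self_of_hammingNorm_mod_two (by omega)) ?_ hsD
        intro v hv
        rw [mem_inf_neighbor] at hv
        exact hsub ⟨hv.1, (hC.1.dotProduct_shadow_eq_zero_iff hs hv.1).1 hv.2⟩
      exact ((hC.1.neighbor_shadow_doublyEven hs hs4).1.eq_of_le hD.1 hle).symm
    rw [hshadow] at ht
    exact ht.imp (key s₁ hs₁ h₁) (key s₃ hs₃ h₃)
  · have key : ∀ s ∈ shadow C, hammingNorm s % 4 = 0 →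
        IsDoublyEvenSelfDual (neighbor C s) ∧ IsNeighbor C (neighbor C s) := by
      intro s hs hs4
      have hN := hC.1.neighbor_shadow_doublyEven hs hs4
      have := hC.1.finrank_eq_inf_neighbor_add_one hs.2
      exact ⟨hN, hC.1, hN.1, by omega⟩
    rintro (rfl | rfl)
    · exact key s₁ hs₁ h₁
    · exact key s₃ hs₃ h₃

theorem IsSinglyEvenSelfDual.neighbor_ne (hC : IsSinglyEvenSelfDual C)
    {s₁ s₃ : Fin n → ZMod 2} (hs₁ : s₁ ∈ shadow C)
    (h₁ : s₁ ⬝ᵥ s₁ = 0) (h₃ : s₃ ⬝ᵥ s₃ = 0)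
    (hshadow : shadow C = (fun y => s₁ + y) '' doublyEvenPart C ∪
      (fun y => s₃ + y) '' doublyEvenPart C) :
    neighbor C s₁ ≠ neighbor C s₃ := by
  intro heq
  have h₃₁ : s₃ ⬝ᵥ s₁ = 0 := by
    have := self_mem_neighbor (A := C) h₃
    rw [← heq] at this
    exact this.1
  obtain ⟨b, hb, hb4⟩ := hC.2
  have hbs : b ⬝ᵥ s₁ ≠ 0 := fun h => by
    have := (hC.1.dotProduct_shadow_eq_zero_iff hs₁ hb).1 h
    omega
  have hmem := add_mem_shadow hC.1 hs₁ hb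
  rw [hshadow] at hmem
  -- Both cosets consist of vectors orthogonal to `s₁`.
  refine hbs ?_
  have hb' : b ⬝ᵥ s₁ = (s₁ + b) ⬝ᵥ s₁ := by rw [add_dotProduct, h₁, zero_add]
  rw [hb']
  rcases hmem with ⟨y, hy, h⟩ | ⟨y, hy, h⟩
  · rw [← h]
    change (s₁ + y) ⬝ᵥ s₁ = 0
    rw [add_dotProduct, h₁, (hC.1.dotProduct_shadow_eq_zero_iff hs₁ hy.1).2 hy.2, add_zero]
  · rw [← h]
    change (s₃ + y) ⬝ᵥ s₁ = 0
    rw [add_dotProduct, h₃₁, (hC.1.dotProduct_shadow_eq_zero_iff hs₁ hy.1).2 hy.2, add_zero]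

end

/-! ### Passing between the two kinds of codes -/

theorem minWeight_shadow_of_isSExtremal {k : ℕ} {C : Code (24 * k + 8)} (hC : IsSExtremal C)
    (hd : minWeight (C : Set (Fin (24 * k + 8) → ZMod 2)) = 4 * k + 2) :
    minWeight (shadow C) = 4 * k + 4 := by
  have h := hC.2
  rw [if_neg (by omega), hd] at h
  omega

/-- The coset of the neighbor to look at is that of a codeword of weight `4k + 2` of `C`: it
consists of the codewords of `C` outside the doubly even part and of a half of the shadow. -/
theorem IsSinglyEvenSelfDual.neighbor_extremal {k : ℕ} {C : Code (24 * k + 8)}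
    (hC : IsSinglyEvenSelfDual C)
    (hd : minWeight (C : Set (Fin (24 * k + 8) → ZMod 2)) = 4 * k + 2)
    (hS : minWeight (shadow C) = 4 * k + 4) {s : Fin (24 * k + 8) → ZMod 2} (hs : s ∈ shadow C)
    (hs4 : hammingNorm s % 4 = 0) :
    IsExtremal (neighbor C s) ∧ coveringRadius (neighbor C s) = 4 * k + 2 ∧
      coveringRadius (neighbor C s) = delsarteBound (neighbor C s) := by
  have hSmin : ∀ t ∈ shadow C, 4 * k + 4 ≤ hammingNorm t := fun t ht =>
    hS ▸ minWeight_le ht fun h => ht.2 (h ▸ C.zero_mem)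
  have hshadow : ∀ v, v + s ∈ C → v ∈ shadow C := fun v hv => by
    have := add_mem_shadow hC.1 hs hv
    rwa [add_comm s, add_add_cancel_self] at this
  obtain ⟨b, hb, hbw⟩ := exists_of_minWeight_eq hd (by omega)
  have hN := hC.1.neighbor_shadow_doublyEven hs hs4
  refine hN.extremal_and_coveringRadius ?_ (x := b) ?_
  · intro v hv h0
    have h4 := hN.2 v hv
    rcases hv.2 with hvC | hvC
    · have : 4 * k + 2 ≤ hammingNorm v := hd ▸ minWeight_le hvC h0
      omega
    · exact hSmin v (hshadow v hvC)
  · intro c hc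
    rcases hc.2 with hcC | hcC
    · rw [← hd]
      refine minWeight_le (C.add_mem hb hcC) fun h0 => ?_
      have hbc : b = c := by rw [← add_add_cancel_self b c, h0, zero_add]
      have := hN.2 c hc
      rw [← hbc, hbw] at this
      omega
    · have := hSmin (b + c) (by rw [add_comm b]; exact add_mem_shadow hC.1 (hshadow c hcC) hb)
      omega

/-- The neighbor at a leader of a coset of minimum weight `4k + 2`. Its shadow is the union of two
sets: the codewords of `D` not orthogonal to the leader, and their translates by the leader. -/
theorem IsDoublyEvenSelfDual.neighbor_isSExtremal {k : ℕ} {D : Code (24 * k + 8)}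
    (hD : IsDoublyEvenSelfDual D)
    (hmin : ∀ v ∈ D, v ≠ 0 → 4 * k + 4 ≤ hammingNorm v)
    {x : Fin (24 * k + 8) → ZMod 2} (hxw : hammingNorm x = 4 * k + 2)
    (hx : ∀ c ∈ D, 4 * k + 2 ≤ hammingNorm (x + c)) :
    IsSExtremal (neighbor D x) ∧
      minWeight (neighbor D x : Set (Fin (24 * k + 8) → ZMod 2)) = 4 * k + 2 := by
  have hxx : x ⬝ᵥ x = 0 := dotProduct_self_of_hammingNorm_mod_two (by omega)
  have hxD : x ∉ D := fun h => by
    have := hx x h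
    rw [add_self_eq_zero, hammingNorm_zero] at this
    omega
  have hcoset : ∀ v, v + x ∈ D → 4 * k + 2 ≤ hammingNorm v := fun v hv => by
    have := hx _ hv
    rwa [add_comm x, add_add_cancel_self] at this
  have hdual : ∀ v ∈ doublyEvenPart (neighbor D x), v ∈ D := by
    rintro v ⟨⟨hvx, hv⟩, h4⟩
    refine hv.resolve_right fun hv => ?_
    have h := hammingNorm_add_mod_four_of_orthogonal (x := v + x) (y := x)
      (by rw [add_dotProduct, hvx, hxx, add_zero])
    rw [add_add_cancel_self] at h
    have := hD.2 _ hv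
    omega
  have hd : minWeight (neighbor D x : Set (Fin (24 * k + 8) → ZMod 2)) = 4 * k + 2 := by
    refine minWeight_eq (by omega) ⟨x, self_mem_neighbor hxx, hxw⟩ fun v hv h0 => ?_
    rcases hv.2 with hv | hv
    · have := hmin v hv h0
      omega
    · exact hcoset v hv
  have hS : minWeight (shadow (neighbor D x)) = 4 * k + 4 := by
    refine minWeight_eq (by omega) ?_ fun v hv h0 => ?_
    · obtain ⟨u, hu, huw, hux⟩ := hD.exists_hammingNorm_eq_not_orthogonal hmin hx
      refine ⟨u, ⟨fun y hy => hD.1.mem_iff.1 hu y (hdual y hy), fun h => ?_⟩, huw⟩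
      simp [h.1] at hux
    · have hv' : v ∈ D ∨ v + x ∈ D := hD.1.mem_or_add_mem hxD fun a ha hax =>
        hv.1 a ⟨⟨hax, Or.inl ha⟩, hD.2 a ha⟩
      have hvx : v ⬝ᵥ x ≠ 0 := fun h => hv.2 ⟨h, hv'⟩
      rcases hv' with hv' | hv'
      · exact hmin v hv' h0
      · have h := hammingNorm_add_mod_four_of_not_orthogonal (x := v + x) (y := x)
          (by rwa [add_dotProduct, hxx, add_zero])
        rw [add_add_cancel_self] at h
        have := hD.2 _ hv'
        have := hcoset v hv'
        omega
  refine ⟨⟨⟨hD.1.neighbor hxD hxx, x, self_mem_neighbor hxx, by omega⟩, ?_⟩, hd⟩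
  rw [if_neg (by omega), hd, hS]
  omega

end BinaryCode

theorem theorem1 (k : ℕ) :
    (∀ C : BinaryCode.Code (24 * k + 8),
      BinaryCode.IsSExtremal C →
      BinaryCode.HasParams C (12 * k + 4) (4 * k + 2) →
      (∃ C₁ C₂ C₃ : Set (Fin (24 * k + 8) → ZMod 2),
        BinaryCode.IsCosetDecomposition C C₁ C₂ C₃) ∧
      ∀ C₁ C₂ C₃ : Set (Fin (24 * k + 8) → ZMod 2),
        BinaryCode.IsCosetDecomposition C C₁ C₂ C₃ →
        ∃ D₁ D₃ : BinaryCode.Code (24 * k + 8),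
          (D₁ : Set (Fin (24 * k + 8) → ZMod 2)) = BinaryCode.doublyEvenPart C ∪ C₁ ∧
          (D₃ : Set (Fin (24 * k + 8) → ZMod 2)) = BinaryCode.doublyEvenPart C ∪ C₃ ∧
          D₁ ≠ D₃ ∧
          (∀ D : BinaryCode.Code (24 * k + 8),
            (BinaryCode.IsDoublyEvenSelfDual D ∧ BinaryCode.IsNeighbor C D) ↔
              (D = D₁ ∨ D = D₃)) ∧
          ∀ D : BinaryCode.Code (24 * k + 8), (D = D₁ ∨ D = D₃) →
            BinaryCode.IsExtremal D ∧
            BinaryCode.coveringRadius D = 4 * k + 2 ∧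
            BinaryCode.coveringRadius D = BinaryCode.delsarteBound D) ∧
    (∀ D : BinaryCode.Code (24 * k + 8),
      BinaryCode.IsDoublyEvenSelfDual D →
      BinaryCode.IsExtremal D →
      BinaryCode.HasParams D (12 * k + 4) (4 * k + 4) →
      BinaryCode.coveringRadius D = 4 * k + 2 →
      ∃ C : BinaryCode.Code (24 * k + 8),
        BinaryCode.IsNeighbor D C ∧
        BinaryCode.IsSExtremal C ∧
        BinaryCode.HasParams C (12 * k + 4) (4 * k + 2)) := by
  refine ⟨fun C hC hp => ?_, fun D hD _ hp hcov => ?_⟩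
  · have hS := BinaryCode.minWeight_shadow_of_isSExtremal hC hp.2
    obtain ⟨s, hs, hsw⟩ := BinaryCode.exists_of_minWeight_eq hS (by omega)
    have h4 : ∀ t ∈ BinaryCode.shadow C, hammingNorm t % 4 = 0 := fun t ht =>
      hC.1.1.shadow_hammingNorm_mod_four hs (by omega) ht
    have h2 : ∀ t ∈ BinaryCode.shadow C, t ⬝ᵥ t = 0 := fun t ht =>
      BinaryCode.dotProduct_self_of_hammingNorm_mod_two (by have := h4 t ht; omega)
    refine ⟨hC.1.exists_isCosetDecomposition hs, fun C₁ C₂ C₃ hdec => ?_⟩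
    obtain ⟨s₁, hs₁, s₃, hs₃, rfl, rfl⟩ := hdec.exists_representatives
    refine ⟨BinaryCode.neighbor C s₁, BinaryCode.neighbor C s₃,
      hC.1.1.coe_neighbor_shadow hs₁ (h2 _ hs₁), hC.1.1.coe_neighbor_shadow hs₃ (h2 _ hs₃),
      hC.1.neighbor_ne hs₁ (h2 _ hs₁) (h2 _ hs₃) hdec.shadow_eq,
      hC.1.doublyEven_neighbor_iff hs₁ hs₃ (h4 _ hs₁) (h4 _ hs₃) hdec.shadow_eq
        (by rw [hp.1]; omega), ?_⟩
    rintro D (rfl | rfl)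
    · exact hC.1.neighbor_extremal hp.2 hS hs₁ (h4 _ hs₁)
    · exact hC.1.neighbor_extremal hp.2 hS hs₃ (h4 _ hs₃)
  · obtain ⟨x, hxw, hx⟩ := BinaryCode.exists_coset_leader hcov (by omega)
    have hxx : x ⬝ᵥ x = 0 := BinaryCode.dotProduct_self_of_hammingNorm_mod_two (by omega)
    have hxD : x ∉ D := fun h => by
      have := hx x h
      rw [BinaryCode.add_self_eq_zero, hammingNorm_zero] at this
      omega
    obtain ⟨hext, hd⟩ := hD.neighbor_isSExtremal
      (fun v hv h0 => hp.2 ▸ BinaryCode.minWeight_le hv h0) hxw hx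
    have hr := hD.1.finrank_eq_inf_neighbor_add_one hxD
    have hr' := BinaryCode.finrank_neighbor_eq_inf_add_one hxD hxx
    have hdim := hp.1
    exact ⟨BinaryCode.neighbor D x, ⟨hD.1, hext.1.1, by omega⟩, hext, by omega, hd⟩
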